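/- Let $\Sigma=\{0,1,\$\}$. A nondeterministic B\"uchi automaton (NBA) over $\Sigma$ has a finite set of states $Q$, an initial state $q_0$, a transition function $\delta\colon Q\times\Sigma\to 2^Q$ and a set $F\subseteq Q$ of final states; it accepts an $\omega$-word if some run on it from $q_0$ visits $F$ infinitely often. It is *separating* if any two different states $p\neq q$ accept disjoint languages (when taken as initial state). It is a *reachability automaton* if it has exactly one final state $f$ and $\delta(f,\sigma)=\{f\}$ for all $\sigma$; a *reachability language* is the language of a reachability automaton. A finite MDP $M$ has finite sets of states $S$ and of actions $\mathrm{Act}$ and probabilities $P(s,a,\sigma,s')\ge 0$ with $\sum_{\sigma,s'}P(s,a,\sigma,s')\le 1$ (action $a$ in state $s$ emits $\sigma$ and moves to $s'$; with the missing probability the run stops). Strategies are history dependent and randomised. For an NBA $A$, $\mathrm{PSem}^M_A(s)$ is the supremum over the strategies of $M$ of the probability that the run from $s$ is infinite and emits a word in $L(A)$. $\mathrm{PSyn}^M_A(s)$ is the supremum over the strategies of the product $M\times A$ of the probability that the run from $(s,q_0)$ is infinite and visits $S\times F$ infinitely often; here a strategy chooses an action of $M$ and, for each letter $\sigma$ that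 may be emitted, the state $q'$ to which the automaton moves (if $q'\notin\delta(q,\sigma)$, the run stops). $A$ is *good-for-MDPs* (GfM) if $\mathrm{PSyn}^M_A(s)=\mathrm{PSem}^M_A(s)$ for all finite MDPs $M$ and all states $s$ of $M$. For $n\ge 1$ let $L_n=\{0,1\}^*1\{0,1\}^{n-1}\$$ and $L_n^r=L_n\,\Sigma^\omega$. Let $R_n'$ be the NBA with states $q_0,\dots,q_n,f$, initial state $q_0$, final states $q_n$ and $f$, and the transitions: $q_0\to q_0$ on $0$ and $1$; $q_0\to q_1$ on $1$; $q_i\to q_{i+1}$ on $0$ and $1$ for $1\le i<n$; $q_n\to q$ on $\$$ for every state $q$; $f\to f$ on $0$ and $1$; $f\to q_1$ on $0$. **Theorem.** (1) For every $n\ge1$, $R_n'$ is a separating NBA with $n+2$ states and $3(n+2)$ transitions, it recognises $L_n^r$, which is a reachability language, and every GfM NBA that recognises $L_n^r$ has at least $2^n$ states. (2) Hence separating automata that recognise reachability languages are exponentially more succinct than GfM automata: there is a constant $c>0$ such that, for all sufficiently large $m$, there is a separating NBA $A$ over $\Sigma$ with at most $m$ states and at most $m$ transitions whose language is a reachability language,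 such that every GfM NBA with the language $L(A)$ has at least $2^{cm}$ states. -/

import Mathlib

open scoped ENNReal

namespace GoodForMDP

/-! ### Nondeterministic Büchi automata -/

/-- A nondeterministic Büchi word automaton (NBA) over the alphabet `α`, with finitely many
states. An `ω`-word over `α` is a function `ℕ → α`. -/
structure NBA (α : Type) where
  State : Type
  [fintypeState : Fintype State]
  init : State
  δ : State → α → Set State
  final : Set State

attribute [instance] NBA.fintypeState

namespace NBA

variable {α : Type}

/-- `r` is a run of `A` on the `ω`-word `x`. -/
def IsRun (A : NBA α) (x : ℕ → α) (r : ℕ → A.State) : Prop :=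
  r 0 = A.init ∧ ∀ i, r (i + 1) ∈ A.δ (r i) (x i)

/-- The language of an NBA: the `ω`-words with a run that visits final states infinitely often. -/
def lang (A : NBA α) : Set (ℕ → α) :=
  {x | ∃ r, A.IsRun x r ∧ ∃ᶠ i in Filter.atTop, r i ∈ A.final}

/-- The automaton `A_q`, obtained from `A` by making `q` the initial state. -/
def withInit (A : NBA α) (q : A.State) : NBA α where
  State := A.State
  init := q
  δ := A.δ
  final := A.final

/-- Different states have disjoint languages. -/
def IsSeparating (A : NBA α) : Prop :=
  ∀ p q : A.State, p ≠ q → Disjoint (A.withInit p).lang (A.withInit q).lang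

/-- There is a single final state, and this state is a sink. -/
def IsReachability (A : NBA α) : Prop :=
  ∃ f : A.State, A.final = {f} ∧ ∀ σ, A.δ f σ = {f}

/-- The number of states. -/
noncomputable def numStates (A : NBA α) : ℕ := Nat.card A.State

/-- The number of transitions `(q, σ, q')` with `q' ∈ δ(q, σ)`. -/
noncomputable def numTransitions (A : NBA α) : ℕ :=
  Nat.card {t : A.State × α × A.State // t.2.2 ∈ A.δ t.1 t.2.1}

end NBA

/-- A reachability language is a language recognised by some reachability automaton. -/
def IsReachabilityLanguage {α : Type} (L : Set (ℕ → α)) : Prop :=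
  ∃ A : NBA α, A.IsReachability ∧ A.lang = L

/-! ### Markov decision processes -/

/-- A finite, transition-labelled Markov decision process over the alphabet `α`. The number
`prob s a σ t` is the probability that action `a`, taken in state `s`, emits the letter `σ` and
moves to `t`; for fixed `s` and `a` these numbers form a subdistribution, and where the
transition `(s, a, σ)` is undefined they are all zero. -/
structure MDP (α : Type) [Fintype α] where
  State : Type
  Act : Type
  [fintypeState : Fintype State]
  [fintypeAct : Fintype Act]
  prob : State → Act → α → State → ℝ≥0∞
  sum_prob_le_one : ∀ s a, ∑ σ, ∑ t, prob s a σ t ≤ 1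

attribute [instance] MDP.fintypeState MDP.fintypeAct

namespace MDP

variable {α : Type} [Fintype α]

/-- One step of a run: the action taken, the letter emitted, the state reached. -/
abbrev Move (M : MDP α) : Type := M.Act × α × M.State

/-- The outcome of one round: a move, or `none` if the run has stopped (which happens with the
probability that the subdistribution is missing). -/
def Outcome (M : MDP α) : Type := Option M.Move

noncomputable instance (M : MDP α) : Fintype M.Outcome :=
  inferInstanceAs (Fintype (Option M.Move))

instance (M : MDP α) : MeasurableSpace M.Outcome := ⊤

instance (M : MDP α) : DiscreteMeasurableSpace M.Outcome := ⟨fun _ => trivial⟩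

/-- The letter and the state after taking action `a` in state `s`; the missing probability mass
is put on `none`. -/
noncomputable def step (M : MDP α) (s : M.State) (a : M.Act) : PMF (Option (α × M.State)) :=
  PMF.ofFintype
    (fun o => o.elim (1 - ∑ σ, ∑ t, M.prob s a σ t) (fun p => M.prob s a p.1 p.2))
    (by
      rw [Fintype.sum_option, Fintype.sum_prod_type]
      exact tsub_add_cancel_of_le (M.sum_prob_le_one s a))

/-- A strategy maps each finite run, given by its first state and its list of moves, to a
probability distribution on the actions. (An action that is not available, i.e. has no
transitions, stops the run, so allowing it does not change any of the suprema below.) -/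
abbrev Strategy (M : MDP α) : Type := M.State → List M.Move → PMF M.Act

/-- The last state of the finite run with first state `s` and list of moves `h`. -/
def lastState (M : MDP α) (s : M.State) (h : List M.Move) : M.State :=
  (h.getLast?.map fun m => m.2.2).getD s

/-- The distribution of the next outcome after the finite run `(s, h)` under the strategy `μ`. -/
noncomputable def next (M : MDP α) (μ : M.Strategy) (s : M.State) (h : List M.Move) :
    PMF M.Outcome :=
  (μ s h).bind fun a =>
    (M.step (M.lastState s h) a).map fun o => (o.map fun p => (a, p) : Option M.Move)

open Classical in
/-- The distribution of the next outcome after a list of outcomes: a stopped run stays stopped. -/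
noncomputable def nextOutcome (M : MDP α) (μ : M.Strategy) (s : M.State)
    (l : List (Option M.Move)) : PMF M.Outcome :=
  if none ∈ l then PMF.pure (none : Option M.Move) else M.next μ s l.reduceOption

/-- The transition kernel from the outcomes of the rounds `0, …, n` to that of round `n + 1`. -/
noncomputable def kernel (M : MDP α) (μ : M.Strategy) (s : M.State) (n : ℕ) :
    ProbabilityTheory.Kernel ((_ : Finset.Iic n) → M.Outcome) M.Outcome :=
  ProbabilityTheory.Kernel.ofFunOfCountable fun x =>
    (M.nextOutcome μ s (List.ofFn fun i : Fin (n + 1) =>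
      x ⟨i, Finset.mem_Iic.2 (Nat.lt_succ_iff.1 i.2)⟩)).toMeasure

instance (M : MDP α) (μ : M.Strategy) (s : M.State) (n : ℕ) :
    ProbabilityTheory.IsMarkovKernel (M.kernel μ s n) :=
  ⟨fun _ => PMF.toMeasure.isProbabilityMeasure _⟩

/-- The probability measure on sequences of outcomes that is induced by the strategy `μ` and the
initial state `s` (Ionescu-Tulcea). -/
noncomputable def runMeasure (M : MDP α) (μ : M.Strategy) (s : M.State) :
    MeasureTheory.Measure (ℕ → M.Outcome) :=
  ProbabilityTheory.Kernel.trajMeasure (X := fun _ => M.Outcome)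
    (M.next μ s []).toMeasure (M.kernel μ s)

/-- The probability, under the strategy `μ` from `s`, that the run is infinite and its sequence
of moves lies in `E`. -/
noncomputable def prRun (M : MDP α) (μ : M.Strategy) (s : M.State) (E : Set (ℕ → M.Move)) :
    ℝ≥0∞ :=
  M.runMeasure μ s {ω | ∃ r : ℕ → M.Move, (∀ i, ω i = (some (r i) : Option M.Move)) ∧ r ∈ E}

/-- The semantic satisfaction probability: the supremum over the strategies of `M` of the
probability that the emitted `ω`-word is in the language of `A`. -/
noncomputable def PSem (M : MDP α) (A : NBA α) (s : M.State) : ℝ≥0∞ :=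
  ⨆ μ : M.Strategy, M.prRun μ s {r | (fun i => (r i).2.1) ∈ A.lang}

open Classical in
/-- The product of `M` and `A`. An action of the product is an action `a` of `M` together with a
resolution `ρ` of the nondeterminism of `A`, which names, for each letter `σ` that `a` may emit,
the successor state `ρ σ` that `A` moves to upon reading it. If `ρ σ` is not a `σ`-successor, the
automaton blocks and the probability mass is lost. -/
noncomputable def product (M : MDP α) (A : NBA α) : MDP α where
  State := M.State × A.State
  Act := M.Act × (α → A.State)
  prob := fun s a σ t =>
    if t.2 = a.2 σ ∧ t.2 ∈ A.δ s.2 σ then M.prob s.1 a.1 σ t.1 else 0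
  sum_prob_le_one := by
    intro s a
    refine le_trans (Finset.sum_le_sum fun σ _ => ?_) (M.sum_prob_le_one s.1 a.1)
    rw [Fintype.sum_prod_type]
    refine Finset.sum_le_sum fun t _ => ?_
    refine le_trans (Finset.sum_le_sum fun q _ => ?_)
      (le_of_eq (Fintype.sum_ite_eq' (a.2 σ) fun _ => M.prob s.1 a.1 σ t))
    by_cases h : q = a.2 σ
    · simp only [h, if_true]
      split_ifs <;> simp
    · simp [h]

/-- The syntactic satisfaction probability: the supremum over the strategies of the product of
the probability that the run visits `F^× = {(s, q) | q ∈ F}` infinitely often. -/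
noncomputable def PSyn (M : MDP α) (A : NBA α) (s : M.State) : ℝ≥0∞ :=
  ⨆ μ : (M.product A).Strategy, (M.product A).prRun μ (s, A.init)
    {r | ∃ᶠ i in Filter.atTop, (r i).2.2 ∈ {c : M.State × A.State | c.2 ∈ A.final}}

end MDP

/-- An NBA is good for MDPs (GfM) if the syntactic and the semantic satisfaction probability
agree for all finite MDPs and all initial states. -/
def NBA.IsGfM {α : Type} [Fintype α] (A : NBA α) : Prop :=
  ∀ (M : MDP α) (s : M.State), M.PSyn A s = M.PSem A s

/-! ### Succinctness -/

/-- The automata in the class `C` are exponentially more succinct than those in the class `D`: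
translating an automaton in `C` with at most `m` states and transitions into a language equivalent
automaton in `D` requires `2 ^ Ω(m)` states in the worst case. -/
def ExponentiallyMoreSuccinct {α : Type} (C D : NBA α → Prop) : Prop :=
  ∃ c : ℝ, 0 < c ∧ ∀ᶠ m : ℕ in Filter.atTop,
    ∃ A : NBA α, C A ∧ A.numStates ≤ m ∧ A.numTransitions ≤ m ∧
      ∀ B : NBA α, D B → B.lang = A.lang → (2 : ℝ) ^ (c * m) ≤ B.numStates

/-! ### The languages and the automata -/

/-- The alphabet `{0, 1, $}`. -/
inductive Letter
  | zero
  | one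
  | dollar
  deriving DecidableEq

instance : Fintype Letter :=
  ⟨{Letter.zero, Letter.one, Letter.dollar}, fun x => by cases x <;> simp⟩

/-- `L_n = {0,1}* 1 {0,1}^(n-1) $`. -/
def finLang (n : ℕ) : Language Letter :=
  {w | ∃ u v : List Letter, Letter.dollar ∉ u ∧ Letter.dollar ∉ v ∧ v.length + 1 = n ∧
    w = u ++ [Letter.one] ++ v ++ [Letter.dollar]}

/-- The concatenation of a finite word and an `ω`-word. -/
def appendWord {α : Type} (w : List α) (x : ℕ → α) : ℕ → α :=
  fun i => if h : i < w.length then w[i] else x (i - w.length)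

/-- `L_n^r = {w {0,1,$}^ω | w ∈ L_n}`. -/
def reachLang (n : ℕ) : Set (ℕ → Letter) :=
  {x | ∃ w ∈ finLang n, ∃ y : ℕ → Letter, x = appendWord w y}

/-- The transitions of `R_n'`, where the number `i ≤ n` stands for `q_i` and `n + 1` for `f`. -/
inductive SepTrans (n : ℕ) : ℕ → Letter → ℕ → Prop
  | loop_init (σ : Letter) : σ ≠ Letter.dollar → SepTrans n 0 σ 0
  | start : SepTrans n 0 Letter.one 1
  | move (i : ℕ) (σ : Letter) : 1 ≤ i → i < n → σ ≠ Letter.dollar → SepTrans n i σ (i + 1)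
  | dollar (j : ℕ) : SepTrans n n Letter.dollar j
  | loop_f (σ : Letter) : σ ≠ Letter.dollar → SepTrans n (n + 1) σ (n + 1)
  | restart : SepTrans n (n + 1) Letter.zero 1

/-- The automaton `R_n'` with the states `q_0, …, q_n, f`, of which `q_n` and `f` are final. -/
def sepNBA (n : ℕ) : NBA Letter where
  State := Fin (n + 2)
  init := 0
  δ := fun p σ => {p' | SepTrans n p σ p'}
  final := {p | (p : ℕ) = n ∨ (p : ℕ) = n + 1}

end GoodForMDP

/-! Upper bound: `sepNBA n` is reverse deterministic and reverse complete: each pair (letter, target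
state) has exactly one source (`SepTrans.source_unique`, `SepTrans.exists_source`). The restart `f →
q_1` on `0` supplies the one source that would otherwise be missing. Every word `y` therefore has
exactly one state that accepts it, namely `wordClass n y`, which is read off from the position of
the first `$` and the letter `n` places before it (`mem_lang_withInit_sepNBA`). Separation and the
language follow at once, and the three letters with `n + 2` targets give `3 (n + 2)` transitions.

Lower bound: let finitely many accepted words agree before time `m`. A Markov chain that draws one
of them uniformly at time `m` emits an accepted word almost surely, so a GfM automaton must also
reach syntactic probability 1. Its state at time `m` is fixed before the draw; if every such state
failed on the tail of some word, that word would be drawn with probability `1/|ι|` and the run would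
fail. Hence some state at time `m` accepts all the tails (`NBA.IsGfM.exists_state`). For each `w` in
`{0,1}^n` this is applied to words that begin with `w` and whose tails test the single bits of `w`.
The resulting state determines `w`, so there are at least `2^n` states
(`NBA.IsGfM.two_pow_le_numStates`). -/

namespace GoodForMDP

open MeasureTheory ProbabilityTheory

/-! ### Bounds on the probabilities of runs of an MDP -/

namespace MDP

variable {α : Type} [Fintype α] (M : MDP α)

instance (μ : M.Strategy) (s : M.State) : IsProbabilityMeasure (M.runMeasure μ s) :=
  inferInstanceAs (IsProbabilityMeasure (Kernel.trajMeasure (X := fun _ => M.Outcome)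
    (M.next μ s []).toMeasure (M.kernel μ s)))

theorem runMeasure_map_eval_zero (μ : M.Strategy) (s : M.State) :
    (M.runMeasure μ s).map (fun ω => ω 0) = (M.next μ s []).toMeasure := by
  have h : (fun ω : ℕ → M.Outcome => ω 0) =
      (MeasurableEquiv.piUnique fun _ : Finset.Iic 0 => M.Outcome) ∘
        Preorder.frestrictLe (π := fun _ => M.Outcome) 0 := rfl
  have h1 : (M.runMeasure μ s).map (Preorder.frestrictLe (π := fun _ => M.Outcome) 0) =
      (M.next μ s []).toMeasure.map
        (MeasurableEquiv.piUnique fun _ : Finset.Iic 0 => M.Outcome).symm := by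
    rw [runMeasure, Kernel.trajMeasure, Measure.map_comp _ _ (by fun_prop),
      Kernel.traj_map_frestrictLe, Kernel.partialTraj_self, Measure.id_comp]
  rw [h, ← Measure.map_map (by fun_prop) (by fun_prop), h1, MeasurableEquiv.map_map_symm]

/-- The target set may depend on the history: a bound on the conditional probability of one round
that is uniform in the history survives integration over the history. Round `0` is separate because
its law is the initial measure and not a kernel. -/
theorem runMeasure_eval_mem_le (μ : M.Strategy) (s : M.State) (k : ℕ)
    (B : List (Option M.Move) → Set M.Outcome) (c : ℝ≥0∞)
    (hB : ∀ l, (M.nextOutcome μ s l).toMeasure (B l) ≤ c) :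
    M.runMeasure μ s {ω | ω k ∈ B (List.ofFn fun i : Fin k => ω i)} ≤ c := by
  cases k with
  | zero =>
    have h := hB []
    rw [nextOutcome, if_neg (by simp)] at h
    simp only [List.reduceOption_nil] at h
    rw [← runMeasure_map_eval_zero, Measure.map_apply (by fun_prop) MeasurableSet.of_discrete] at h
    exact h
  | succ n =>
    let B' : Set ((Finset.Iic n → M.Outcome) × M.Outcome) :=
      {p | p.2 ∈ B (List.ofFn fun i : Fin (n + 1) =>
        p.1 ⟨i, Finset.mem_Iic.2 (Nat.lt_succ_iff.1 i.2)⟩)}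
    have hB' : MeasurableSet B' := MeasurableSet.of_discrete
    have key := Kernel.map_frestrictLe_trajMeasure_compProd_eq_map_trajMeasure
      (X := fun _ => M.Outcome) (μ₀ := (M.next μ s []).toMeasure) (κ := M.kernel μ s) (a := n)
    have h1 : M.runMeasure μ s {ω | ω (n + 1) ∈ B (List.ofFn fun i : Fin (n + 1) => ω i)} =
        ((M.runMeasure μ s).map fun ω =>
          (Preorder.frestrictLe (π := fun _ => M.Outcome) n ω, ω (n + 1))) B' := by
      rw [Measure.map_apply (by fun_prop) hB']
      rfl
    rw [h1, runMeasure, ← key, Measure.compProd_apply hB']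
    have : IsProbabilityMeasure ((Kernel.trajMeasure (X := fun _ => M.Outcome)
        (M.next μ s []).toMeasure (M.kernel μ s)).map
          (Preorder.frestrictLe (π := fun _ => M.Outcome) n)) :=
      Measure.isProbabilityMeasure_map (by fun_prop)
    refine (lintegral_mono (g := fun _ => c) fun x => ?_).trans (by simp)
    exact hB _

/-- The outcome of a round in which the action `a` is taken. -/
def outcome (a : M.Act) (o : Option (α × M.State)) : M.Outcome :=
  (o.map fun p => (a, p) : Option M.Move)

theorem next_eq_bind_outcome (μ : M.Strategy) (s : M.State) (h : List M.Move) :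
    M.next μ s h = (μ s h).bind fun a => (M.step (M.lastState s h) a).map (M.outcome a) :=
  rfl

theorem next_toMeasure_le (μ : M.Strategy) (s : M.State) (h : List M.Move) (B : Set M.Outcome)
    (c : ℝ≥0∞)
    (hB : ∀ a, (M.step (M.lastState s h) a).toOuterMeasure
      (M.outcome a ⁻¹' B) ≤ c) :
    (M.next μ s h).toMeasure B ≤ c := by
  rw [next_eq_bind_outcome, PMF.toMeasure_apply_eq_toOuterMeasure, PMF.toOuterMeasure_bind_apply]
  calc _ ≤ ∑' a, μ s h a * c := by
        refine ENNReal.tsum_le_tsum fun a => ?_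
        gcongr
        rw [PMF.toOuterMeasure_map_apply]
        exact hB a
    _ = c := by rw [ENNReal.tsum_mul_right, PMF.tsum_coe, one_mul]

open Classical in
theorem prRun_move_mem_le (μ : M.Strategy) (s : M.State) (k : ℕ) (C : List M.Move → Set M.Move)
    (c : ℝ≥0∞)
    (hC : ∀ h a, ∑ p : α × M.State,
      (if (a, p) ∈ C h then M.prob (M.lastState s h) a p.1 p.2 else 0) ≤ c) :
    M.prRun μ s {r | r k ∈ C (List.ofFn fun i : Fin k => r i)} ≤ c := by
  -- After a stop the target set is empty, so only histories made of genuine moves have to satisfy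
  -- the bound.
  let B : List (Option M.Move) → Set M.Outcome := fun l =>
    if none ∈ l then ∅ else {o | ∃ m ∈ C l.reduceOption, o = (some m : Option M.Move)}
  refine le_trans (measure_mono ?_) (M.runMeasure_eval_mem_le μ s k B c fun l => ?_)
  · rintro ω ⟨r, hr, hrC⟩
    obtain rfl : ω = fun i => (some (r i) : Option M.Move) := funext hr
    have hl : (List.ofFn fun i : Fin k => (some (r i) : Option M.Move)) =
        (List.ofFn fun i : Fin k => r i).map some := by
      rw [List.map_ofFn]; rfl
    change (some (r k) : Option M.Move) ∈ B (List.ofFn fun i : Fin k => (some (r i) : Option M.Move))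
    rw [hl]
    simp only [B]
    rw [if_neg (by simp)]
    refine ⟨r k, ?_, rfl⟩
    rw [List.reduceOption, List.filterMap_map]
    simpa using hrC
  · rw [nextOutcome]
    simp only [B]
    split_ifs with hl
    · simp
    · refine M.next_toMeasure_le μ s _ _ c fun a => le_trans (le_of_eq ?_) (hC l.reduceOption a)
      rw [PMF.toOuterMeasure_apply_fintype,
        Fintype.sum_option]
      have h0 : (none : Option (α × M.State)) ∉ M.outcome a ⁻¹'
          {o : M.Outcome | ∃ m ∈ C l.reduceOption, o = (some m : Option M.Move)} := by
        rintro ⟨m, -, hm⟩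
        cases hm
      rw [Set.indicator_of_notMem h0, zero_add]
      refine Finset.sum_congr rfl fun p _ => ?_
      rw [Set.indicator_apply]
      refine if_congr ?_ rfl rfl
      constructor
      · rintro ⟨m, hm, h⟩
        cases h
        exact hm
      · intro h
        exact ⟨_, h, rfl⟩

/-- The state in which the move number `i` of the run from `s` with the moves `r` is made. -/
def stateAt (s : M.State) (r : ℕ → M.Move) : ℕ → M.State
  | 0 => s
  | i + 1 => (r i).2.2

theorem lastState_ofFn (s : M.State) (r : ℕ → M.Move) (k : ℕ) :
    M.lastState s (List.ofFn fun i : Fin k => r i) = M.stateAt s r k := by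
  cases k with
  | zero => simp [lastState, stateAt]
  | succ k =>
    rw [lastState, List.ofFn_succ', List.concat_eq_append, List.getLast?_concat]
    rfl

/-- All moves of the run have positive probability. -/
def IsPossibleRun (s : M.State) (r : ℕ → M.Move) : Prop :=
  ∀ i, M.prob (M.stateAt s r i) (r i).1 (r i).2.1 (r i).2.2 ≠ 0

theorem prRun_mono (μ : M.Strategy) (s : M.State) {E E' : Set (ℕ → M.Move)} (h : E ⊆ E') :
    M.prRun μ s E ≤ M.prRun μ s E' :=
  measure_mono fun _ ⟨r, hr, hE⟩ => ⟨r, hr, h hE⟩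

theorem prRun_union_le (μ : M.Strategy) (s : M.State) (E E' : Set (ℕ → M.Move)) :
    M.prRun μ s (E ∪ E') ≤ M.prRun μ s E + M.prRun μ s E' := by
  refine le_trans (measure_mono ?_) (measure_union_le _ _)
  rintro ω ⟨r, hr, h | h⟩
  exacts [Or.inl ⟨r, hr, h⟩, Or.inr ⟨r, hr, h⟩]

/-- An impossible run has a first-principles witness: some round `k` with a move of probability
zero. Each round contributes a null set, and there are countably many rounds. -/
theorem prRun_not_isPossibleRun (μ : M.Strategy) (s : M.State) :
    M.prRun μ s {r | ¬ M.IsPossibleRun s r} = 0 := by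
  have h : ∀ k, M.prRun μ s
      {r | M.prob (M.stateAt s r k) (r k).1 (r k).2.1 (r k).2.2 = 0} = 0 := by
    intro k
    refine le_antisymm ?_ zero_le
    refine le_trans (M.prRun_mono μ s ?_) (M.prRun_move_mem_le μ s k
      (fun h => {m | M.prob (M.lastState s h) m.1 m.2.1 m.2.2 = 0}) 0 fun h a => ?_)
    · intro r hr
      simpa only [Set.mem_ofPred_eq, lastState_ofFn] using hr
    · refine le_of_eq (Finset.sum_eq_zero fun p _ => ?_)
      split_ifs with hp
      · exact hp
      · rfl
  refine measure_mono_null ?_ (measure_iUnion_null h)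
  rintro ω ⟨r, hr, hE⟩
  simp only [IsPossibleRun, Set.mem_ofPred_eq, not_forall, not_not] at hE
  obtain ⟨k, hk⟩ := hE
  exact Set.mem_iUnion.2 ⟨k, r, hr, hk⟩

/-- Only possible runs matter for an upper bound on probabilities. -/
theorem prRun_le_of_isPossibleRun (μ : M.Strategy) (s : M.State) {E E' : Set (ℕ → M.Move)}
    (h : ∀ r ∈ E, M.IsPossibleRun s r → r ∈ E') : M.prRun μ s E ≤ M.prRun μ s E' := by
  refine le_trans (M.prRun_mono μ s (E' := E' ∪ {r | ¬ M.IsPossibleRun s r}) fun r hr => ?_) ?_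
  · by_cases hp : M.IsPossibleRun s r
    exacts [Or.inl (h r hr hp), Or.inr hp]
  · refine (M.prRun_union_le μ s _ _).trans ?_
    rw [prRun_not_isPossibleRun, add_zero]

theorem runMeasure_exists_eq_none (hM : ∀ s a, ∑ σ, ∑ t, M.prob s a σ t = 1)
    (μ : M.Strategy) (s : M.State) :
    M.runMeasure μ s {ω | ∃ k, ω k = (none : Option M.Move)} = 0 := by
  classical
  let B : List (Option M.Move) → Set M.Outcome := fun l =>
    if none ∈ l then ∅ else {(none : Option M.Move)}
  have h : ∀ k, M.runMeasure μ s {ω | ω k ∈ B (List.ofFn fun i : Fin k => ω i)} = 0 := by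
    intro k
    refine le_antisymm (M.runMeasure_eval_mem_le μ s k B 0 fun l => ?_) zero_le
    simp only [B]
    rw [nextOutcome]
    split_ifs with hl
    · simp
    · refine M.next_toMeasure_le μ s _ _ 0 fun a => le_of_eq ?_
      rw [PMF.toOuterMeasure_apply_fintype]
      refine Finset.sum_eq_zero fun o _ => ?_
      cases o with
      | none =>
        have : M.step (M.lastState s l.reduceOption) a none = 0 := by
          simp [step, hM]
        simp [this]
      | some p =>
        refine Set.indicator_of_notMem ?_ _
        intro h
        cases h
  refine measure_mono_null ?_ (measure_iUnion_null h)
  intro ω hω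
  have hω' : ∃ k, ω k = (none : Option M.Move) := hω
  -- The first stop is the only one that `B` records, since `B` is empty once the run has stopped.
  refine Set.mem_iUnion.2 ⟨Nat.find hω', ?_⟩
  have hn : (none : Option M.Move) ∉ List.ofFn fun i : Fin (Nat.find hω') => ω i := by
    intro h
    obtain ⟨i, hi⟩ := List.mem_ofFn.1 h
    exact Nat.find_min hω' i.2 hi
  have hB : B (List.ofFn fun i : Fin (Nat.find hω') => ω i) = {(none : Option M.Move)} :=
    if_neg hn
  exact (Set.ext_iff.1 hB _).2 (Nat.find_spec hω')

/-- If no run stops, an event that contains all possible runs is almost sure. -/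
theorem prRun_eq_one (hM : ∀ s a, ∑ σ, ∑ t, M.prob s a σ t = 1)
    (μ : M.Strategy) (s : M.State) {E : Set (ℕ → M.Move)}
    (hE : ∀ r, M.IsPossibleRun s r → r ∈ E) : M.prRun μ s E = 1 := by
  refine le_antisymm prob_le_one ?_
  -- `E` need not be measurable, so the lower bound comes from covering the whole space and
  -- subadditivity, not from complements.
  have h1 : 1 ≤ M.prRun μ s Set.univ + M.runMeasure μ s {ω | ∃ k, ω k = (none : Option M.Move)} := by
    rw [← measure_univ (μ := M.runMeasure μ s)]
    refine le_trans (measure_mono ?_) (measure_union_le _ _)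
    intro ω _
    by_cases h : ∃ k, ω k = (none : Option M.Move)
    · exact Or.inr h
    · push Not at h
      have h' : ∀ k, ∃ m, ω k = (some m : Option M.Move) := fun k => Option.ne_none_iff_exists'.1 (h k)
      choose r hr using h'
      exact Or.inl ⟨r, hr, trivial⟩
  rw [runMeasure_exists_eq_none M hM, add_zero] at h1
  exact h1.trans (M.prRun_le_of_isPossibleRun μ s fun r _ hr => hE r hr)

end MDP

/-! ### The product against its MDP component -/

namespace MDP

variable {α : Type} [Fintype α]

open Classical in
-- For a fixed letter `σ`, only the automaton successor `a.2 σ` carries mass, so resolving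
-- nondeterminism cannot make a move of the MDP component more likely.
theorem sum_product_prob_le (M : MDP α) (A : NBA α) (s : (M.product A).State)
    (a : (M.product A).Act) (D : Set M.State) :
    ∑ p : α × (M.product A).State,
        (if p.2.1 ∈ D then (M.product A).prob s a p.1 p.2 else 0) ≤
      ∑ σ, ∑ t, if t ∈ D then M.prob s.1 a.1 σ t else 0 := by
  rw [Fintype.sum_prod_type]
  refine Finset.sum_le_sum fun σ _ => ?_
  change ∑ p : M.State × A.State, _ ≤ _
  rw [Fintype.sum_prod_type]
  refine Finset.sum_le_sum fun t _ => ?_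
  by_cases ht : t ∈ D
  · simp only [ht, if_true]
    refine le_trans (Finset.sum_le_sum fun q _ => ?_)
      (le_of_eq (Fintype.sum_ite_eq' (a.2 σ) fun _ => M.prob s.1 a.1 σ t))
    by_cases h : q = a.2 σ
    · simp only [product, h, if_true]
      split_ifs <;> simp
    · simp [product, h]
  · simp [ht]

theorem product_prob_ne_zero {M : MDP α} {A : NBA α} {s t : (M.product A).State}
    {a : (M.product A).Act} {σ : α} (h : (M.product A).prob s a σ t ≠ 0) :
    t.2 ∈ A.δ s.2 σ ∧ M.prob s.1 a.1 σ t.1 ≠ 0 := by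
  simp only [product] at h
  split_ifs at h with h'
  · exact ⟨h'.2, h⟩
  · exact absurd rfl h

end MDP

/-! ### A Markov chain that draws one of finitely many words -/

section Resample

variable {α ι : Type} [Fintype ι]

/-- The successor on `{0, …, T}`, where `T` is a fixed point. -/
def clockSucc {T : ℕ} (t : Fin (T + 1)) : Fin (T + 1) :=
  ⟨min (t + 1) T, Nat.lt_succ_of_le (min_le_right _ _)⟩

open Classical in
/-- The probabilities of the Markov chain that emits one of the words `x j`, where the index `j`
is drawn uniformly at time `m`. -/
noncomputable def resampleProb (x : ι → ℕ → α) (m T : ℕ) (s : Fin (T + 1) × ι) (σ : α)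
    (t : Fin (T + 1) × ι) : ℝ≥0∞ :=
  if t.1 = clockSucc s.1 then
    if (s.1 : ℕ) = m ∨ t.2 = s.2 then
      -- The letter belongs to the word of the target index, so the letter emitted at time `m`
      -- already reflects the new draw.
      if σ = x t.2 s.1 then
        if (s.1 : ℕ) = m then (Fintype.card ι : ℝ≥0∞)⁻¹ else 1
      else 0
    else 0
  else 0

open Classical in
theorem sum_resampleProb_ite [Fintype α] (x : ι → ℕ → α) (m T : ℕ) (s : Fin (T + 1) × ι)
    (D : Set ι) :
    ∑ σ, ∑ t, (if t.2 ∈ D then resampleProb x m T s σ t else 0) =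
      ∑ j, if j ∈ D then (if (s.1 : ℕ) = m ∨ j = s.2 then
        if (s.1 : ℕ) = m then (Fintype.card ι : ℝ≥0∞)⁻¹ else 1 else 0) else 0 := by
  rw [Finset.sum_comm, Fintype.sum_prod_type, Finset.sum_comm]
  refine Finset.sum_congr rfl fun j _ => ?_
  by_cases hj : j ∈ D
  · simp only [hj, if_true, resampleProb]
    rw [Finset.sum_comm]
    simp only [Finset.sum_ite_eq', Finset.mem_univ, if_true]
    by_cases h : (s.1 : ℕ) = m ∨ j = s.2
    · simp [h]
    · simp [h]
  · simp [hj]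

theorem sum_resampleProb [Fintype α] [Nonempty ι] (x : ι → ℕ → α) (m T : ℕ)
    (s : Fin (T + 1) × ι) : ∑ σ, ∑ t, resampleProb x m T s σ t = 1 := by
  classical
  have h := sum_resampleProb_ite x m T s Set.univ
  simp only [Set.mem_univ, if_true] at h
  rw [h]
  by_cases hm : (s.1 : ℕ) = m
  · simp only [hm, true_or, if_true, Finset.sum_const, Finset.card_univ, nsmul_eq_mul]
    exact ENNReal.mul_inv_cancel (by simp) (by simp)
  · simp [hm]

/-- The Markov chain that emits one of the words `x j`, where the index `j` is drawn uniformly at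
time `m`. -/
noncomputable def resampleChain [Fintype α] [Nonempty ι] (x : ι → ℕ → α) (m T : ℕ) : MDP α where
  State := Fin (T + 1) × ι
  Act := Unit
  prob := fun s _ σ t => resampleProb x m T s σ t
  sum_prob_le_one := fun s _ => (sum_resampleProb x m T s).le

theorem resampleProb_ne_zero {x : ι → ℕ → α} {m T : ℕ} {s t : Fin (T + 1) × ι} {σ : α}
    (h : resampleProb x m T s σ t ≠ 0) :
    (t.1 : ℕ) = min ((s.1 : ℕ) + 1) T ∧ ((s.1 : ℕ) = m ∨ t.2 = s.2) ∧ σ = x t.2 s.1 := by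
  unfold resampleProb at h
  split_ifs at h with h1 h2 h3
  · exact ⟨by rw [h1]; rfl, h2, h3⟩
  · exact ⟨by rw [h1]; rfl, h2, h3⟩
  all_goals exact absurd rfl h

/-- A path of positive probability emits one of the words. -/
theorem resample_path {x : ι → ℕ → α} {m T : ℕ} (hmT : m < T)
    (hagree : ∀ i j, ∀ t < m, x i t = x j t) (hconst : ∀ j, ∀ t ≥ T, x j t = x j T)
    {s : ℕ → Fin (T + 1) × ι} {σ : ℕ → α} (h0 : ((s 0).1 : ℕ) = 0)
    (hs : ∀ i, resampleProb x m T (s i) (σ i) (s (i + 1)) ≠ 0) :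
    (∀ i, ((s i).1 : ℕ) = min i T) ∧ σ = x (s (m + 1)).2 := by
  have ht : ∀ i, ((s i).1 : ℕ) = min i T := by
    intro i
    induction i with
    | zero => simpa using h0
    | succ i ih =>
      rw [(resampleProb_ne_zero (hs i)).1, ih]
      omega
  have hlate : ∀ i, (s (m + 1 + i)).2 = (s (m + 1)).2 := by
    intro i
    induction i with
    | zero => rfl
    | succ i ih =>
      rw [← ih]
      -- The clock sticks at `T > m`, so it shows `m` only once and the index is never redrawn.
      refine (resampleProb_ne_zero (hs (m + 1 + i))).2.1.resolve_left ?_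
      rw [ht]
      omega
  refine ⟨ht, funext fun i => ?_⟩
  rw [(resampleProb_ne_zero (hs i)).2.2, ht]
  rcases lt_or_ge i m with hi | hi
  · rw [min_eq_left (by omega)]
    exact hagree _ _ i hi
  · obtain ⟨k, rfl⟩ := Nat.exists_eq_add_of_le hi
    rw [show m + k + 1 = m + 1 + k by ring, hlate]
    rcases le_total (m + k) T with h | h
    · rw [min_eq_left h]
    · rw [min_eq_right h, hconst _ _ h]

end Resample

/-! ### Resolving nondeterminism before the word is known -/

/-- A good-for-MDPs automaton that accepts the words `x j`, which agree before time `m` and are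
eventually constant, can resolve its nondeterminism before time `m` without knowing `j`. -/
theorem NBA.IsGfM.exists_state {α ι : Type} [Fintype α] [Fintype ι] [Nonempty ι] {A : NBA α}
    (hA : A.IsGfM) (x : ι → ℕ → α) (m T : ℕ) (hmT : m < T)
    (hagree : ∀ i j, ∀ t < m, x i t = x j t) (hconst : ∀ j, ∀ t ≥ T, x j t = x j T)
    (hx : ∀ j, x j ∈ A.lang) :
    ∃ r : ℕ → A.State, r 0 = A.init ∧ (∀ j, ∀ i < m, r (i + 1) ∈ A.δ (r i) (x j i)) ∧
      ∀ j, (fun t => x j (m + t)) ∈ (A.withInit (r m)).lang := by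
  classical
  by_contra hcon
  push Not at hcon
  -- The failing index can be chosen as a function of the state `q` alone, because acceptance of the
  -- tail depends on the path only through its state at time `m`. An unreachable `q` gets an
  -- arbitrary index.
  have hbad : ∀ q : A.State, ∃ j, ∀ r : ℕ → A.State, r 0 = A.init →
      (∀ j, ∀ i < m, r (i + 1) ∈ A.δ (r i) (x j i)) → r m = q →
        (fun t => x j (m + t)) ∉ (A.withInit q).lang := by
    intro q
    by_cases hq : ∃ r : ℕ → A.State, r 0 = A.init ∧
      (∀ j, ∀ i < m, r (i + 1) ∈ A.δ (r i) (x j i)) ∧ r m = q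
    · obtain ⟨r, h0, h1, rfl⟩ := hq
      obtain ⟨j, hj⟩ := hcon r h0 h1
      exact ⟨j, fun _ _ _ _ => hj⟩
    · exact ⟨Classical.arbitrary ι, fun r h0 h1 h2 => absurd ⟨r, h0, h1, h2⟩ hq⟩
  choose bad hbad using hbad
  let M := resampleChain x m T
  let s₀ : M.State := ((0 : Fin (T + 1)), Classical.arbitrary ι)
  have hsem : M.PSem A s₀ = 1 := by
    refine le_antisymm (iSup_le fun μ => MeasureTheory.prob_le_one) ?_
    refine le_trans (le_of_eq ?_) (le_iSup _ fun _ _ => PMF.pure ())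
    refine (M.prRun_eq_one (fun s _ => sum_resampleProb x m T s) _ s₀ fun r hr => ?_).symm
    have := (resample_path hmT hagree hconst (s := M.stateAt s₀ r) (σ := fun i => (r i).2.1)
      rfl hr).2
    change (fun i => (r i).2.1) ∈ A.lang
    rw [this]
    exact hx _
  have hc : ∀ b : ι, (∑ j : ι, if j ≠ b then (Fintype.card ι : ℝ≥0∞)⁻¹ else 0) =
      (Fintype.card ι - 1 : ℕ) * (Fintype.card ι : ℝ≥0∞)⁻¹ := by
    intro b
    rw [← Finset.sum_filter, Finset.sum_const, Finset.filter_ne', Finset.card_erase_of_mem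
      (Finset.mem_univ _), Finset.card_univ, nsmul_eq_mul]
  have hc1 : ((Fintype.card ι - 1 : ℕ) : ℝ≥0∞) * (Fintype.card ι : ℝ≥0∞)⁻¹ < 1 := by
    rw [← div_eq_mul_inv, ENNReal.div_lt_iff (by simp) (by simp), one_mul, Nat.cast_lt]
    exact Nat.sub_lt Fintype.card_pos one_pos
  let s₁ : (M.product A).State := (s₀, A.init)
  -- An accepting run must avoid the index that is bad for its state at time `m`. Whatever the
  -- history, the uniform draw does so with probability `(|ι| - 1)/|ι|`.
  have hsyn : M.PSyn A s₀ ≤ (Fintype.card ι - 1 : ℕ) * (Fintype.card ι : ℝ≥0∞)⁻¹ := by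
    refine iSup_le fun μ => ?_
    let C : List (M.product A).Move → Set (M.product A).Move := fun h =>
      {mv | (((M.product A).lastState s₁ h).1.1 : ℕ) = m ∧
        mv.2.2.1.2 ≠ bad ((M.product A).lastState s₁ h).2}
    refine le_trans ((M.product A).prRun_le_of_isPossibleRun μ s₁
      (E' := {r | r m ∈ C (List.ofFn fun i : Fin m => r i)}) fun r hr hpos => ?_)
      ((M.product A).prRun_move_mem_le μ s₁ m C _ fun h a => ?_)
    · have hpos' := fun i => MDP.product_prob_ne_zero (hpos i)
      obtain ⟨ht, hσ⟩ := resample_path hmT hagree hconst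
        (s := fun i => ((M.product A).stateAt s₁ r i).1)
        (σ := fun i => (r i).2.1) rfl (fun i => (hpos' i).2)
      let q : ℕ → A.State := fun i => ((M.product A).stateAt s₁ r i).2
      have hq : ∀ i, q (i + 1) ∈ A.δ (q i) (r i).2.1 := fun i => (hpos' i).1
      change _ ∧ _
      rw [MDP.lastState_ofFn]
      refine ⟨by rw [ht]; omega, fun hj => ?_⟩
      change (((M.product A).stateAt s₁ r (m + 1)).1).2 = bad (q m) at hj
      have hσ' : ∀ i, (r i).2.1 = x (bad (q m)) i := fun i => by
        rw [← hj]; exact congrFun hσ i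
      refine hbad (q m) q rfl (fun j i hi => ?_) rfl ⟨fun i => q (m + i), ⟨rfl, fun i => ?_⟩, ?_⟩
      · rw [hagree j (bad (q m)) i hi, ← hσ']
        exact hq i
      · change q (m + i + 1) ∈ A.δ (q (m + i)) (x (bad (q m)) (m + i))
        rw [← hσ']
        exact hq _
      -- Acceptance in the product looks at the state reached by move `i`, which is `q (i + 1)`;
      -- this explains the shift in the witness `b + 1 - m`.
      · have hr' : ∃ᶠ i in Filter.atTop, q (i + 1) ∈ A.final := hr
        rw [Filter.frequently_atTop] at hr' ⊢
        intro N
        obtain ⟨b, hb, hbq⟩ := hr' (m + N)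
        refine ⟨b + 1 - m, by omega, ?_⟩
        change q (m + (b + 1 - m)) ∈ A.final
        rwa [show m + (b + 1 - m) = b + 1 by omega]
    · by_cases hm : (((M.product A).lastState s₁ h).1.1 : ℕ) = m
      · let b := bad ((M.product A).lastState s₁ h).2
        refine le_trans (le_of_eq ?_) ((M.sum_product_prob_le A
          ((M.product A).lastState s₁ h) a {t | t.2 ∈ {j | j ≠ b}}).trans (le_of_eq ?_))
        · refine Finset.sum_congr rfl fun p _ => ?_
          by_cases hp : p.2.1.2 ≠ b
          · rw [if_pos (show (a, p) ∈ C h from ⟨hm, hp⟩)]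
            exact (if_pos hp).symm
          · rw [if_neg (show (a, p) ∉ C h from fun h' => hp h'.2)]
            exact (if_neg hp).symm
        · refine (sum_resampleProb_ite x m T _ {j | j ≠ b}).trans ?_
          simp only [hm, true_or, if_true]
          exact hc b
      · refine le_trans (le_of_eq (Finset.sum_eq_zero fun p _ => if_neg ?_)) zero_le
        exact fun h => hm h.1
  have := hA M s₀
  rw [hsem] at this
  exact absurd (this ▸ hsyn) (not_le.2 hc1)

/-- A finite path of the automaton followed by an accepting run is an accepting run. -/
theorem NBA.mem_lang_of_path {α : Type} {A : NBA α} {x : ℕ → α} {m : ℕ} {r : ℕ → A.State}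
    (h0 : r 0 = A.init) (hr : ∀ i < m, r (i + 1) ∈ A.δ (r i) (x i))
    (hx : (fun t => x (m + t)) ∈ (A.withInit (r m)).lang) : x ∈ A.lang := by
  obtain ⟨r', ⟨h0', hr'⟩, hacc⟩ : ∃ r' : ℕ → A.State,
    (r' 0 = r m ∧ ∀ i, r' (i + 1) ∈ A.δ (r' i) (x (m + i))) ∧
      ∃ᶠ i in Filter.atTop, r' i ∈ A.final := hx
  refine ⟨fun t => if t ≤ m then r t else r' (t - m), ⟨by simpa using h0, fun i => ?_⟩, ?_⟩
  · change (if i + 1 ≤ m then r (i + 1) else r' (i + 1 - m)) ∈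
      A.δ (if i ≤ m then r i else r' (i - m)) (x i)
    rcases lt_or_ge i m with hi | hi
    · rw [if_pos (by omega), if_pos (by omega)]
      exact hr i hi
    · obtain ⟨k, rfl⟩ := Nat.exists_eq_add_of_le hi
      have hk : r' (k + 1) ∈ A.δ (r' k) (x (m + k)) := hr' k
      rw [if_neg (show ¬ m + k + 1 ≤ m by omega), show m + k + 1 - m = k + 1 by omega]
      split_ifs with h
      · obtain rfl : k = 0 := by omega
        rw [h0'] at hk
        exact hk
      · rwa [show m + k - m = k by omega]
  · rw [Filter.frequently_atTop] at hacc ⊢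
    intro N
    obtain ⟨b, hb, hbF⟩ := hacc (N + 1)
    refine ⟨m + b, by omega, ?_⟩
    change (if m + b ≤ m then r (m + b) else r' (m + b - m)) ∈ A.final
    rw [if_neg (by omega), show m + b - m = b by omega]
    exact hbF

/-! ### Classification of words by the first occurrence of `$` -/

/-- The first `$` of the word `y` is at position `d`. -/
def FirstDollar (y : ℕ → Letter) (d : ℕ) : Prop :=
  y d = Letter.dollar ∧ ∀ t < d, y t ≠ Letter.dollar

theorem FirstDollar.unique {y : ℕ → Letter} {d d' : ℕ} (h : FirstDollar y d)
    (h' : FirstDollar y d') : d = d' := by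
  rcases lt_trichotomy d d' with hd | hd | hd
  · exact absurd h.1 (h'.2 d hd)
  · exact hd
  · exact absurd h'.1 (h.2 d' hd)

theorem exists_firstDollar {y : ℕ → Letter} (h : ∃ d, y d = Letter.dollar) :
    ∃ d, FirstDollar y d := by
  classical
  exact ⟨Nat.find h, Nat.find_spec h, fun t ht => Nat.find_min h ht⟩

theorem FirstDollar.shift {y : ℕ → Letter} {d : ℕ} (h : FirstDollar y (d + 1)) :
    FirstDollar (fun t => y (t + 1)) d :=
  ⟨h.1, fun t ht => h.2 (t + 1) (by omega)⟩

open Classical in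
/-- The number of the unique state from which `sepNBA n` accepts the word `y`. -/
noncomputable def wordClass (n : ℕ) (y : ℕ → Letter) : ℕ :=
  if h : ∃ d, FirstDollar y d then
    if h.choose < n then n - h.choose
    else if y (h.choose - n) = Letter.one then 0 else n + 1
  else n + 1

theorem wordClass_of_firstDollar (n : ℕ) {y : ℕ → Letter} {d : ℕ} (h : FirstDollar y d) :
    wordClass n y = if d < n then n - d else if y (d - n) = Letter.one then 0 else n + 1 := by
  have h' : ∃ d, FirstDollar y d := ⟨d, h⟩
  rw [wordClass, dif_pos h', h'.choose_spec.unique h]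

theorem wordClass_of_forall_ne (n : ℕ) {y : ℕ → Letter} (h : ∀ d, y d ≠ Letter.dollar) :
    wordClass n y = n + 1 :=
  dif_neg fun ⟨d, hd⟩ => h d hd.1

theorem wordClass_lt (n : ℕ) (y : ℕ → Letter) : wordClass n y < n + 2 := by
  unfold wordClass
  split_ifs <;> omega

/-- The classes of the suffixes of a word form a run. Dropping a letter brings the first `$` one
step closer; when its distance falls from `n` to `n - 1`, the dropped letter decides between `start`
(from `q_0`) and `restart` (from `f`). -/
theorem sepTrans_wordClass {n : ℕ} (hn : 1 ≤ n) (y : ℕ → Letter) :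
    SepTrans n (wordClass n y) (y 0) (wordClass n fun t => y (t + 1)) := by
  by_cases h : ∃ d, y d = Letter.dollar
  · obtain ⟨d, hd⟩ := exists_firstDollar h
    cases d with
    | zero =>
      rw [wordClass_of_firstDollar n hd, if_pos (by omega), hd.1]
      exact SepTrans.dollar _
    | succ d =>
      have h0 := hd.2 0 (by omega)
      rw [wordClass_of_firstDollar n hd, wordClass_of_firstDollar n hd.shift]
      rcases lt_trichotomy (d + 1) n with hdn | hdn | hdn
      · rw [if_pos hdn, if_pos (show d < n by omega), show n - d = n - (d + 1) + 1 by omega]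
        exact SepTrans.move _ _ (by omega) (by omega) h0
      · rw [if_neg (show ¬ d + 1 < n by omega), if_pos (show d < n by omega), show d + 1 - n = 0 by omega,
          show n - d = 1 by omega]
        rcases hy : y 0 with _ | _ | _
        · simpa using SepTrans.restart
        · simpa using SepTrans.start
        · exact absurd hy h0
      · rw [if_neg (show ¬ d + 1 < n by omega), if_neg (show ¬ d < n by omega), show d + 1 - n = d - n + 1 by omega]
        split_ifs
        · exact SepTrans.loop_init _ h0
        · exact SepTrans.loop_f _ h0
  · push Not at h
    rw [wordClass_of_forall_ne n h, wordClass_of_forall_ne n fun d => h (d + 1)]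
    exact SepTrans.loop_f _ (h 0)

theorem SepTrans.source_unique {n : ℕ} (hn : 1 ≤ n) {p p' j : ℕ} {σ : Letter}
    (h : SepTrans n p σ j) (h' : SepTrans n p' σ j) : p = p' := by
  cases h <;> cases h' <;> first | rfl | omega | contradiction

theorem SepTrans.eq_of_dollar {n p j : ℕ} (h : SepTrans n p Letter.dollar j) : p = n := by
  cases h <;> first | rfl | contradiction

theorem SepTrans.dollar_of_source {n j : ℕ} {σ : Letter} (hn : 1 ≤ n) (h : SepTrans n n σ j) :
    σ = Letter.dollar := by
  cases h <;> first | rfl | omega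

theorem SepTrans.exists_source {n : ℕ} (hn : 1 ≤ n) (σ : Letter) {j : ℕ} (hj : j < n + 2) :
    ∃ p < n + 2, SepTrans n p σ j := by
  by_cases hσ : σ = Letter.dollar
  · subst hσ
    exact ⟨n, by omega, SepTrans.dollar j⟩
  · rcases Nat.eq_zero_or_pos j with rfl | hj0
    · exact ⟨0, by omega, SepTrans.loop_init σ hσ⟩
    rcases Nat.eq_or_lt_of_le (Nat.lt_succ_iff.1 hj) with rfl | hjn
    · exact ⟨n + 1, by omega, SepTrans.loop_f σ hσ⟩
    rcases Nat.eq_or_lt_of_le (Nat.succ_le_of_lt hj0) with rfl | hj1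
    · cases σ with
      | zero => exact ⟨n + 1, by omega, SepTrans.restart⟩
      | one => exact ⟨0, by omega, SepTrans.start⟩
      | dollar => exact absurd rfl hσ
    · obtain ⟨i, rfl⟩ : ∃ i, j = i + 1 := ⟨j - 1, by omega⟩
      exact ⟨i, by omega, SepTrans.move i σ (by omega) (by omega) hσ⟩

/-- By reverse determinism, a run that agrees with the run of classes at one time agrees with it at
all earlier times. A `$` forces agreement, since it can only be read in `q_n`. Without any `$`, the
state `q_n` cannot be left, so acceptance means a visit to `f`, which is the class of every suffix.
Conversely, the run of classes is in `q_n` at each `$`, and stays in `f` once no `$` remains. -/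
theorem mem_lang_withInit_sepNBA {n : ℕ} (hn : 1 ≤ n) (p : Fin (n + 2)) (y : ℕ → Letter) :
    y ∈ ((sepNBA n).withInit p).lang ↔ (p : ℕ) = wordClass n y := by
  constructor
  · rintro ⟨r, ⟨h0, hr⟩, hacc⟩
    have hr' : ∀ i, SepTrans n (r i : Fin (n + 2)).val (y i) (r (i + 1) : Fin (n + 2)).val := hr
    have hback : ∀ t, (r t : Fin (n + 2)).val = wordClass n (fun i => y (i + t)) →
        (r 0 : Fin (n + 2)).val = wordClass n y := by
      intro t
      induction t with
      | zero => exact id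
      | succ t ih =>
        intro h
        refine ih ?_
        have h1 := hr' t
        rw [h] at h1
        have h2 := sepTrans_wordClass hn fun i => y (i + t)
        simp only [zero_add, add_assoc, add_comm 1 t] at h2
        exact h1.source_unique hn h2
    have hp : p = r 0 := h0.symm
    rw [hp]
    by_cases hd : ∃ d, y d = Letter.dollar
    · obtain ⟨d, hd⟩ := hd
      refine hback d ?_
      have h1 := hr' d
      rw [hd] at h1
      rw [h1.eq_of_dollar, wordClass_of_firstDollar n (d := 0) ⟨by simpa using hd, by simp⟩,
        if_pos (by omega), Nat.sub_zero]
    · push Not at hd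
      obtain ⟨t, ht⟩ := hacc.exists
      refine hback t ?_
      rw [wordClass_of_forall_ne n fun i => hd (i + t)]
      rcases ht with ht | ht
      · have h1 := hr' t
        change (r t : Fin (n + 2)).val = n at ht
        rw [ht] at h1
        exact absurd (h1.dollar_of_source hn) (hd t)
      · exact ht
  · intro hp
    refine ⟨fun t => (⟨wordClass n fun i => y (i + t), wordClass_lt n _⟩ : Fin (n + 2)),
      ⟨Fin.ext hp.symm, fun t => ?_⟩, ?_⟩
    · have h := sepTrans_wordClass hn fun i => y (i + t)
      simp only [zero_add, add_assoc, add_comm 1 t] at h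
      exact h
    · by_cases hd : ∃ᶠ t in Filter.atTop, y t = Letter.dollar
      · refine hd.mono fun t ht => Or.inl ?_
        change wordClass n (fun i => y (i + t)) = n
        rw [wordClass_of_firstDollar n (d := 0) ⟨by simpa using ht, by simp⟩,
          if_pos (by omega), Nat.sub_zero]
      · rw [Filter.not_frequently, Filter.eventually_atTop] at hd
        obtain ⟨N, hN⟩ := hd
        refine Filter.Eventually.frequently (Filter.eventually_atTop.2 ⟨N, fun t ht => Or.inr ?_⟩)
        exact wordClass_of_forall_ne n fun i => hN (i + t) (by omega)

theorem mem_reachLang_iff {n : ℕ} {y : ℕ → Letter} (hn : 1 ≤ n) :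
    y ∈ reachLang n ↔ ∃ k, y k = Letter.one ∧ FirstDollar y (k + n) := by
  constructor
  · rintro ⟨w, ⟨u, v, hu, hv, hlen, rfl⟩, z, rfl⟩
    refine ⟨u.length, ?_, ?_, fun t ht => ?_⟩
    · simp [appendWord]
    · have : u.length + n = (u ++ [Letter.one] ++ v).length := by simp; omega
      rw [this, appendWord, dif_pos (by simp), List.getElem_concat_length]
      rfl
    · have ht' : t < (u ++ [Letter.one] ++ v).length := by simp; omega
      rw [appendWord, dif_pos (by simp at ht' ⊢; omega), List.getElem_append_left ht']
      intro h
      have := List.getElem_mem ht'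
      rw [h] at this
      simp [hu, hv] at this
  · rintro ⟨k, hk, hd⟩
    refine ⟨List.ofFn fun i : Fin (k + n + 1) => y i,
      ⟨List.ofFn fun i : Fin k => y i, List.ofFn fun i : Fin (n - 1) => y (k + 1 + i), ?_, ?_, ?_, ?_⟩,
      fun t => y (k + n + 1 + t), ?_⟩
    · intro h
      obtain ⟨i, hi⟩ := List.mem_ofFn.1 h
      exact hd.2 i (by omega) hi
    · intro h
      obtain ⟨i, hi⟩ := List.mem_ofFn.1 h
      exact hd.2 (k + 1 + i) (by omega) hi
    · rw [List.length_ofFn]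
      omega
    · refine List.ext_getElem (by simp; omega) fun i h1 h2 => ?_
      rw [List.length_ofFn] at h1
      simp only [List.getElem_ofFn, List.getElem_append, List.length_append, List.length_ofFn,
        List.length_singleton, List.getElem_singleton]
      split_ifs with h3 h4 h5
      · rfl
      · rw [show i = k by omega, hk]
      · congr 1
        omega
      · rw [show i = k + n by omega, hd.1]
    · funext t
      simp only [appendWord, List.length_ofFn, List.getElem_ofFn]
      split_ifs with h
      · rfl
      · congr 1
        omega

theorem mem_reachLang_iff_wordClass {n : ℕ} {y : ℕ → Letter} (hn : 1 ≤ n) :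
    y ∈ reachLang n ↔ wordClass n y = 0 := by
  rw [mem_reachLang_iff hn]
  constructor
  · rintro ⟨k, hk, hd⟩
    rw [wordClass_of_firstDollar n hd, if_neg (by omega), Nat.add_sub_cancel, if_pos hk]
  · intro h
    by_cases hy : ∃ d, y d = Letter.dollar
    · obtain ⟨d, hd⟩ := exists_firstDollar hy
      rw [wordClass_of_firstDollar n hd] at h
      split_ifs at h with h1 h2
      · omega
      · exact ⟨d - n, h2, by rwa [show d - n + n = d by omega]⟩
    · push Not at hy
      rw [wordClass_of_forall_ne n hy] at h
      omega

theorem lang_sepNBA {n : ℕ} (hn : 1 ≤ n) : (sepNBA n).lang = reachLang n := by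
  ext y
  rw [mem_reachLang_iff_wordClass hn]
  exact (mem_lang_withInit_sepNBA hn 0 y).trans eq_comm

theorem isSeparating_sepNBA {n : ℕ} (hn : 1 ≤ n) : (sepNBA n).IsSeparating := by
  intro p q hpq
  refine Set.disjoint_left.2 fun y hp hq => hpq (Fin.ext ?_)
  exact ((mem_lang_withInit_sepNBA hn p y).1 hp).trans
    ((mem_lang_withInit_sepNBA hn q y).1 hq).symm

theorem numStates_sepNBA (n : ℕ) : (sepNBA n).numStates = n + 2 :=
  Nat.card_fin (n + 2)

/-- Forgetting the source is a bijection from the transitions onto the pairs of a letter and a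
target. -/
theorem numTransitions_sepNBA {n : ℕ} (hn : 1 ≤ n) :
    (sepNBA n).numTransitions = 3 * (n + 2) := by
  have hbij : Function.Bijective
      (fun t : {t : Fin (n + 2) × Letter × Fin (n + 2) // SepTrans n t.1 t.2.1 t.2.2} =>
        t.1.2) := by
    constructor
    · rintro ⟨⟨p, σ, j⟩, h⟩ ⟨⟨p', σ', j'⟩, h'⟩ heq
      obtain ⟨rfl, rfl⟩ := Prod.mk.inj heq
      obtain rfl : p = p' := Fin.ext (h.source_unique hn h')
      rfl
    · rintro ⟨σ, j⟩
      obtain ⟨p, hp, h⟩ := SepTrans.exists_source hn σ j.2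
      exact ⟨⟨(⟨p, hp⟩, σ, j), h⟩, rfl⟩
  refine (Nat.card_eq_of_bijective _ hbij).trans ?_
  rw [Nat.card_prod, Nat.card_fin, Nat.card_eq_fintype_card]
  rfl

/-! ### `L_n^r` is a reachability language -/

/-- The transitions of the reachability automaton for `L_n^r`, with the sink `n + 1`. -/
inductive ReachTrans (n : ℕ) : ℕ → Letter → ℕ → Prop
  | loop_init (σ : Letter) : σ ≠ Letter.dollar → ReachTrans n 0 σ 0
  | start : ReachTrans n 0 Letter.one 1
  | move (i : ℕ) (σ : Letter) : 1 ≤ i → i < n → σ ≠ Letter.dollar → ReachTrans n i σ (i + 1)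
  | dollar : ReachTrans n n Letter.dollar (n + 1)
  | sink (σ : Letter) : ReachTrans n (n + 1) σ (n + 1)

/-- The reachability automaton for `L_n^r`. -/
def reachNBA (n : ℕ) : NBA Letter where
  State := Fin (n + 2)
  init := 0
  δ := fun p σ => {p' | ReachTrans n p σ p'}
  final := {Fin.last (n + 1)}

theorem isReachability_reachNBA (n : ℕ) : (reachNBA n).IsReachability := by
  refine ⟨Fin.last (n + 1), rfl, fun σ => Set.ext fun p => ⟨fun h => ?_, ?_⟩⟩
  · have h' : ReachTrans n (n + 1) σ p.val := h
    refine Fin.ext (?_ : p.val = n + 1)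
    generalize p.val = j at h' ⊢
    cases h' <;> omega
  · rintro rfl
    exact ReachTrans.sink σ

theorem lang_reachNBA {n : ℕ} (hn : 1 ≤ n) : (reachNBA n).lang = reachLang n := by
  ext y
  rw [mem_reachLang_iff hn]
  constructor
  · rintro ⟨r, ⟨h0, hr⟩, hacc⟩
    have hr' : ∀ i, ReachTrans n (r i : Fin (n + 2)).val (y i) (r (i + 1) : Fin (n + 2)).val := hr
    have h0' : (r 0 : Fin (n + 2)).val = 0 := congrArg Fin.val h0
    -- A state number `p` between `1` and `n` counts the letters read since the guessed `1` was met
    -- at position `k`, hence `t = k + p`. The last alternative is permanent and covers the sink.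
    have hinv : ∀ t, ((r t : Fin (n + 2)).val = 0 ∧ ∀ i < t, y i ≠ Letter.dollar) ∨
        (1 ≤ (r t : Fin (n + 2)).val ∧ (r t : Fin (n + 2)).val ≤ n ∧
          (∃ k, y k = Letter.one ∧ t = k + (r t : Fin (n + 2)).val) ∧
            ∀ i < t, y i ≠ Letter.dollar) ∨
        ∃ k, y k = Letter.one ∧ FirstDollar y (k + n) := by
      intro t
      induction t with
      | zero => exact Or.inl ⟨h0', by simp⟩
      | succ t ih =>
        have hlt : y t ≠ Letter.dollar → (∀ i < t, y i ≠ Letter.dollar) →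
            ∀ i < t + 1, y i ≠ Letter.dollar := by
          intro h1 h2 i hi
          rcases Nat.lt_succ_iff_lt_or_eq.1 hi with hi | rfl
          exacts [h2 i hi, h1]
        have hstep := hr' t
        generalize (r (t + 1) : Fin (n + 2)).val = j at hstep ⊢
        generalize (r t : Fin (n + 2)).val = p at hstep ih
        generalize hσ : y t = σ at hstep
        rcases ih with ⟨rfl, h2⟩ | ⟨h1, h2, ⟨k, hk, rfl⟩, h3⟩ | h
        · cases hstep with
          | loop_init _ h => exact Or.inl ⟨rfl, hlt (hσ ▸ h) h2⟩
          | start =>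
            exact Or.inr (Or.inl ⟨le_rfl, hn, ⟨t, hσ, rfl⟩, hlt (by simp [hσ]) h2⟩)
          | move _ _ h => omega
          | dollar => omega
        · cases hstep with
          | loop_init => omega
          | start => omega
          | move _ _ _ h h' =>
            exact Or.inr (Or.inl ⟨by omega, h, ⟨k, hk, rfl⟩, hlt (hσ ▸ h') h3⟩)
          | dollar => exact Or.inr (Or.inr ⟨k, hk, hσ, h3⟩)
          | sink => omega
        · exact Or.inr (Or.inr h)
    obtain ⟨t, ht⟩ := hacc.exists
    have ht' : (r t : Fin (n + 2)).val = n + 1 := congrArg Fin.val ht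
    rcases hinv t with h | h | h
    · omega
    · omega
    · exact h
  · rintro ⟨k, hk, hd⟩
    -- Truncated subtraction keeps this run in state `0` up to time `k`, and the minimum keeps it in
    -- the sink afterwards.
    refine ⟨fun t => (⟨min (t - k) (n + 1), by omega⟩ : Fin (n + 2)),
      ⟨Fin.ext (by simp [reachNBA]), fun t => ?_⟩, ?_⟩
    · change ReachTrans n (min (t - k) (n + 1)) (y t) (min (t + 1 - k) (n + 1))
      rcases lt_trichotomy t k with h | rfl | h
      · rw [show t - k = 0 by omega, show t + 1 - k = 0 by omega, Nat.zero_min]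
        exact ReachTrans.loop_init _ (hd.2 t (by omega))
      · rw [Nat.sub_self, Nat.add_sub_cancel_left, Nat.zero_min, min_eq_left (by omega), hk]
        exact ReachTrans.start
      rcases lt_trichotomy t (k + n) with h' | rfl | h'
      · rw [min_eq_left (by omega), min_eq_left (by omega), show t + 1 - k = t - k + 1 by omega]
        exact ReachTrans.move _ _ (by omega) (by omega) (hd.2 t h')
      · rw [show k + n - k = n by omega, show k + n + 1 - k = n + 1 by omega,
          min_eq_left (by omega), min_self, hd.1]
        exact ReachTrans.dollar
      · rw [min_eq_right (by omega), min_eq_right (by omega)]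
        exact ReachTrans.sink _
    · refine Filter.Eventually.frequently
        (Filter.eventually_atTop.2 ⟨k + n + 1, fun t ht => Fin.ext ?_⟩)
      change min (t - k) (n + 1) = n + 1
      omega

theorem isReachabilityLanguage_reachLang {n : ℕ} (hn : 1 ≤ n) :
    IsReachabilityLanguage (reachLang n) :=
  ⟨reachNBA n, isReachability_reachNBA n, lang_reachNBA hn⟩

/-! ### The lower bound -/

/-- The letter at position `t` of the word over `{0, 1}` given by `w`, continued by `0`. -/
def bitLetter {n : ℕ} (w : Fin n → Bool) (t : ℕ) : Letter :=
  if h : t < n then if w ⟨t, h⟩ then Letter.one else Letter.zero else Letter.zero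

theorem bitLetter_ne_dollar {n : ℕ} (w : Fin n → Bool) (t : ℕ) :
    bitLetter w t ≠ Letter.dollar := by
  unfold bitLetter
  split_ifs <;> simp

theorem bitLetter_val {n : ℕ} (w : Fin n → Bool) (i : Fin n) :
    bitLetter w i = if w i then Letter.one else Letter.zero :=
  dif_pos i.2

/-- The word `w 0^i $^ω` if the letter number `i` of `w` is `1`, and `w 1 0^(n-1) $^ω` if not. -/
def probeWord {n : ℕ} (w : Fin n → Bool) (i : Fin n) (t : ℕ) : Letter :=
  if t < n then bitLetter w t
  else if w i then if t < n + i then Letter.zero else Letter.dollar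
  else if t = n then Letter.one else if t < n + n then Letter.zero else Letter.dollar

theorem probeWord_mem_reachLang {n : ℕ} (hn : 1 ≤ n) (w : Fin n → Bool) (i : Fin n) :
    probeWord w i ∈ reachLang n := by
  have hi := i.2
  rw [mem_reachLang_iff hn]
  by_cases hw : w i
  · refine ⟨i, ?_, ?_, fun t ht => ?_⟩
    · rw [probeWord, if_pos hi, bitLetter_val, if_pos hw]
    · rw [probeWord, if_neg (by omega), if_pos hw, if_neg (by omega)]
    · rw [probeWord]
      split_ifs
      · exact bitLetter_ne_dollar w t
      · simp
      · omega
  · refine ⟨n, ?_, ?_, fun t ht => ?_⟩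
    · rw [probeWord, if_neg (by omega), if_neg hw, if_pos rfl]
    · rw [probeWord, if_neg (by omega), if_neg hw, if_neg (by omega), if_neg (by omega)]
    · rw [probeWord, if_neg hw]
      split_ifs
      · exact bitLetter_ne_dollar w t
      · simp
      · simp

/-- The probes of `w` share the prefix `w` and all lie in the language; the tail `1 0^(n-1) $`
serves a zero bit because it is accepted after any prefix. So one state reached on `w` accepts all
the tails. If `w'` leads to the same state and `w i` is `1`, then `w' 0^i $^ω` is accepted as well.
Its first `$` is at `n + i`, so the letter at position `i` of `w'` must be `1`. -/
theorem NBA.IsGfM.two_pow_le_numStates {n : ℕ} (hn : 1 ≤ n) {A : NBA Letter} (hA : A.IsGfM)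
    (hL : A.lang = reachLang n) : 2 ^ n ≤ A.numStates := by
  have : Nonempty (Fin n) := ⟨⟨0, hn⟩⟩
  have h : ∀ w : Fin n → Bool, ∃ r : ℕ → A.State, r 0 = A.init ∧
      (∀ i, ∀ t < n, r (t + 1) ∈ A.δ (r t) (probeWord w i t)) ∧
        ∀ i, (fun t => probeWord w i (n + t)) ∈ (A.withInit (r n)).lang := by
    intro w
    -- Every probe is constantly `$` from position `n + n` on.
    refine hA.exists_state (probeWord w) n (n + n) (by omega) (fun i j t ht => ?_)
      (fun i t ht => ?_) fun i => hL ▸ probeWord_mem_reachLang hn w i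
    · rw [probeWord, probeWord, if_pos ht, if_pos ht]
    · have hi := i.2
      by_cases hw : w i
      · simp only [probeWord, if_pos hw]
        rw [if_neg (by omega), if_neg (by omega), if_neg (by omega), if_neg (by omega)]
      · simp only [probeWord, if_neg hw]
        rw [if_neg (by omega), if_neg (by omega), if_neg (by omega), if_neg (by omega),
          if_neg (by omega), if_neg (by omega)]
  choose r h0 hr hacc using h
  have key : ∀ w w' i, r w n = r w' n → w i = true → w' i = true := by
    intro w w' i heq hw
    by_contra hw'
    -- The prefix `w'` with the tail of the probe of `w` at bit `i`.
    let z : ℕ → Letter := fun t => if t < n then bitLetter w' t else probeWord w i t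
    have hi := i.2
    have hz : z ∈ A.lang := by
      refine NBA.mem_lang_of_path (m := n) (h0 w') (fun t ht => ?_) ?_
      · have := hr w' i t ht
        rw [probeWord, if_pos ht] at this
        simpa only [z, if_pos ht] using this
      · have := hacc w i
        rw [heq] at this
        convert this using 2 with t
        exact if_neg (by omega)
    rw [hL, mem_reachLang_iff hn] at hz
    obtain ⟨k, hk, hd⟩ := hz
    have hd' : FirstDollar z (i + n) := by
      refine ⟨?_, fun t ht => ?_⟩
      · simp only [z, probeWord]
        rw [if_neg (by omega), if_neg (by omega), if_pos hw, if_neg (by omega)]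
      · simp only [z, probeWord]
        split_ifs
        · exact bitLetter_ne_dollar w' t
        · simp
        · omega
    obtain rfl : k = i := by have := hd.unique hd'; omega
    simp only [z, if_pos hi, bitLetter_val, if_neg hw'] at hk
    cases hk
  have hinj : Function.Injective fun w => r w n := by
    intro w w' heq
    funext i
    exact Bool.eq_iff_iff.2 ⟨key w w' i heq, key w' w i heq.symm⟩
  have := Nat.card_le_card_of_injective _ hinj
  simpa [NBA.numStates] using this

end GoodForMDP

/-! ### The theorem -/

theorem mainTheorem8 :
    (∀ n : ℕ, 1 ≤ n →
      (GoodForMDP.sepNBA n).IsSeparating ∧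
      (GoodForMDP.sepNBA n).numStates = n + 2 ∧
      (GoodForMDP.sepNBA n).numTransitions = 3 * (n + 2) ∧
      (GoodForMDP.sepNBA n).lang = GoodForMDP.reachLang n ∧
      GoodForMDP.IsReachabilityLanguage (GoodForMDP.reachLang n) ∧
      ∀ A : GoodForMDP.NBA GoodForMDP.Letter,
        A.IsGfM → A.lang = GoodForMDP.reachLang n → 2 ^ n ≤ A.numStates) ∧
    GoodForMDP.ExponentiallyMoreSuccinct
      (fun A : GoodForMDP.NBA GoodForMDP.Letter =>
        A.IsSeparating ∧ GoodForMDP.IsReachabilityLanguage A.lang)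
      (fun A : GoodForMDP.NBA GoodForMDP.Letter => A.IsGfM) := by
  refine ⟨fun n hn => ⟨GoodForMDP.isSeparating_sepNBA hn, GoodForMDP.numStates_sepNBA n,
    GoodForMDP.numTransitions_sepNBA hn, GoodForMDP.lang_sepNBA hn,
    GoodForMDP.isReachabilityLanguage_reachLang hn,
    fun A hA hL => hA.two_pow_le_numStates hn hL⟩, 1 / 6, by norm_num, ?_⟩
  filter_upwards [Filter.eventually_ge_atTop 18] with m hm
  -- This is the largest `n` with `3 (n + 2) ≤ m`. From `m ≥ 18` it follows that `n ≥ 4`, hence `m ≤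
  -- 3 n + 8 ≤ 6 n`, which gives the constant `1/6`.
  obtain ⟨n, hn⟩ : ∃ n, n = m / 3 - 2 := ⟨_, rfl⟩
  have hn1 : 1 ≤ n := by omega
  refine ⟨GoodForMDP.sepNBA n, ⟨GoodForMDP.isSeparating_sepNBA hn1, ?_⟩, ?_, ?_, fun B hB hL => ?_⟩
  · rw [GoodForMDP.lang_sepNBA hn1]
    exact GoodForMDP.isReachabilityLanguage_reachLang hn1
  · rw [GoodForMDP.numStates_sepNBA]
    omega
  · rw [GoodForMDP.numTransitions_sepNBA hn1]
    omega
  · rw [GoodForMDP.lang_sepNBA hn1] at hL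
    have h1 : m ≤ 6 * n := by omega
    have h2 : (m : ℝ) ≤ 6 * n := by exact_mod_cast h1
    calc (2 : ℝ) ^ (1 / 6 * (m : ℝ)) ≤ (2 : ℝ) ^ (n : ℝ) :=
          Real.rpow_le_rpow_of_exponent_le one_le_two (by linarith)
      _ = ((2 ^ n : ℕ) : ℝ) := by rw [Real.rpow_natCast]; push_cast; rfl
      _ ≤ B.numStates := by exact_mod_cast hB.two_pow_le_numStates hn1 hL
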